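/- Let $\Delta_+$ be the category of all finite ordinals $[n]=\{0<\dots<n\}$, $n\ge -1$ (including the empty one $[-1]$), and order-preserving maps, regarded as a simplicial set via its nerve; with the ordinal sum $\oplus$ and unit $[-1]$ it is a simplicial monoid. Let $\mathsf{Mnd}$ be the simplicial category with one object $+$, hom-space $\mathsf{Mnd}(+,+)=\Delta_+$, composition $\oplus$ and identity $[-1]$. Let $A$ be a quasi-category and let $T\colon \mathsf{Mnd}\to \mathsf{qCat}_\infty$ be a homotopy coherent monad on $A$, i.e. a simplicial functor with $T(+)=A$; equivalently, a left action of the simplicial monoid $\Delta_+$ on $A$. Let $\Delta[t]$ be the (nerve of the) category of nonempty finite ordinals and order-preserving maps that preserve the top element, with the left $\Delta_+$-action given by $\oplus$. The quasi-category of algebras $A[t]$ is the limit of $T$ weighted by $\Delta[t]$: its $n$-simplices are the $\Delta_+$-equivariant maps $\Delta^n\times\Delta[t]\to A$. The forgetful functor $u^t\colon A[t]\to A$ is the component of the limit cone at the vertex $[0]\in\Delta[t]$, i.e. restriction along $\Delta^n\times\{[0]\}\hookrightarrow\Delta^n\times\Delta[t]$. Call a vertex $x$ of a simplicial set $X$ a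 terminal object (or terminal) if every map $\partial\Delta^n\to X$ with $n\ge 1$ that sends the final vertex $\{n\}$ to $x$ extends along $\partial\Delta^n\hookrightarrow\Delta^n$. **Proposition.** The functor $u^t\colon A[t]\to A$ creates terminal objects: if $a$ is a terminal object of $A$, then there is an object $\bar a$ of $A[t]$ with $u^t\bar a=a$, and every object $\bar a$ of $A[t]$ with $u^t\bar a=a$ is terminal in $A[t]$. Explicitly, if $a$ is a terminal object of $A$, then for every $n\ge 0$ and all maps $v\colon\partial\Delta^n\to A[t]$ and $w\colon\Delta^n\to A$ such that $u^t\circ v=w|_{\partial\Delta^n}$ and $w$ sends the final vertex $\{n\}$ of $\Delta^n$ to $a$, there is a map $l\colon\Delta^n\to A[t]$ with $l|_{\partial\Delta^n}=v$ and $u^t\circ l=w$. -/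

import Mathlib

open CategoryTheory MonoidalCategory Simplicial Opposite

universe u

namespace HCMonad

/-! ### Finite ordinals and the ordinal sum -/

/-- The ordinal sum `f ⊕ g` of two order-preserving maps between finite ordinals. -/
def ordSum {a b c d : ℕ} (f : Fin a →o Fin b) (g : Fin c →o Fin d) :
    Fin (a + c) →o Fin (b + d) where
  toFun := Fin.addCases (fun i => Fin.castAdd d (f i)) (fun j => Fin.natAdd b (g j))
  monotone' := by
    intro i j
    refine Fin.addCases (fun i => ?_) (fun i => ?_) i <;>
      refine Fin.addCases (fun j => ?_) (fun j => ?_) j <;> intro h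
    · simp only [Fin.addCases_left]
      exact f.monotone h
    · simp only [Fin.addCases_left, Fin.addCases_right]
      rw [Fin.le_def]
      simp only [Fin.val_castAdd, Fin.val_natAdd]
      have := (f i).isLt
      lia
    · exfalso
      rw [Fin.le_def] at h
      simp only [Fin.val_castAdd, Fin.val_natAdd] at h
      have := j.isLt
      lia
    · simp only [Fin.addCases_right]
      have h' : i ≤ j := by
        rw [Fin.le_def] at h ⊢
        simp only [Fin.val_natAdd] at h
        lia
      have := g.monotone h'
      rw [Fin.le_def] at this ⊢
      simp only [Fin.val_natAdd]
      lia

@[simp]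
lemma ordSum_castAdd {a b c d : ℕ} (f : Fin a →o Fin b) (g : Fin c →o Fin d) (i : Fin a) :
    ordSum f g (Fin.castAdd c i) = Fin.castAdd d (f i) :=
  Fin.addCases_left (motive := fun _ => Fin (b + d))
    (left := fun i => Fin.castAdd d (f i)) (right := fun j => Fin.natAdd b (g j)) i

@[simp]
lemma ordSum_natAdd {a b c d : ℕ} (f : Fin a →o Fin b) (g : Fin c →o Fin d) (j : Fin c) :
    ordSum f g (Fin.natAdd a j) = Fin.natAdd b (g j) :=
  Fin.addCases_right (motive := fun _ => Fin (b + d))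
    (left := fun i => Fin.castAdd d (f i)) (right := fun j => Fin.natAdd b (g j)) j

lemma ordSum_id (a c : ℕ) :
    ordSum (OrderHom.id : Fin a →o Fin a) (OrderHom.id : Fin c →o Fin c) = OrderHom.id := by
  ext i : 2
  refine Fin.addCases (fun i => ?_) (fun i => ?_) i <;> simp

lemma ordSum_comp {a b c a' b' c' : ℕ} (f : Fin a →o Fin b) (g : Fin b →o Fin c)
    (f' : Fin a' →o Fin b') (g' : Fin b' →o Fin c') :
    ordSum (g.comp f) (g'.comp f') = (ordSum g g').comp (ordSum f f') := by
  ext i : 2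
  refine Fin.addCases (fun i => ?_) (fun i => ?_) i <;> simp

lemma ordSum_val_of_lt {a b c d : ℕ} (f : Fin a →o Fin b) (g : Fin c →o Fin d)
    (i : Fin (a + c)) (h : i.val < a) : (ordSum f g i).val = (f ⟨i.val, h⟩).val := by
  have : i = Fin.castAdd c ⟨i.val, h⟩ := by ext; simp
  conv_lhs => rw [this]
  rw [ordSum_castAdd, Fin.val_castAdd]

lemma ordSum_val_of_ge {a b c d : ℕ} (f : Fin a →o Fin b) (g : Fin c →o Fin d)
    (i : Fin (a + c)) (h : a ≤ i.val) :
    (ordSum f g i).val = b + (g ⟨i.val - a, by have := i.isLt; lia⟩).val := by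
  have : i = Fin.natAdd a ⟨i.val - a, by have := i.isLt; lia⟩ := by ext; simp; lia
  conv_lhs => rw [this]
  rw [ordSum_natAdd, Fin.val_natAdd]

/-- The category of all finite ordinals `{0 < ⋯ < len - 1}`, the empty one included, and
order-preserving maps. The ordinal with `len` elements is the one usually written `[len - 1]`. -/
structure DeltaPlus : Type u where
  /-- the number of elements of the ordinal -/
  len : ℕ

/-- Morphisms of `DeltaPlus`: order-preserving maps. -/
@[ext]
structure DeltaPlus.Hom (a b : DeltaPlus.{u}) where
  /-- the underlying order-preserving map -/
  map : Fin a.len →o Fin b.len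

instance : Category.{0} DeltaPlus.{u} where
  Hom := DeltaPlus.Hom
  id _ := ⟨OrderHom.id⟩
  comp f g := ⟨g.map.comp f.map⟩

/-- The category of nonempty finite ordinals `[top] = {0 < ⋯ < top}` and the order-preserving
maps that preserve the top element. -/
structure DeltaTop : Type u where
  /-- the top element of the ordinal -/
  top : ℕ

/-- Morphisms of `DeltaTop`: order-preserving maps that preserve the top element. -/
@[ext]
structure DeltaTop.Hom (a b : DeltaTop.{u}) where
  /-- the underlying order-preserving map -/
  map : Fin (a.top + 1) →o Fin (b.top + 1)
  map_last : map (Fin.last a.top) = Fin.last b.top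

instance : Category.{0} DeltaTop.{u} where
  Hom := DeltaTop.Hom
  id _ := ⟨OrderHom.id, rfl⟩
  comp f g := ⟨g.map.comp f.map, by simp [f.map_last, g.map_last]⟩

lemma DeltaPlus.hom_ext {a b : DeltaPlus.{u}} {f g : a ⟶ b}
    (h : ∀ i, (f.map i).val = (g.map i).val) : f = g :=
  DeltaPlus.Hom.ext (OrderHom.ext _ _ (funext fun i => Fin.ext (h i)))

lemma DeltaTop.hom_ext {a b : DeltaTop.{u}} {f g : a ⟶ b}
    (h : ∀ i, (f.map i).val = (g.map i).val) : f = g :=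
  DeltaTop.Hom.ext (OrderHom.ext _ _ (funext fun i => Fin.ext (h i)))

lemma DeltaPlus.comp_map {a b c : DeltaPlus.{u}} (f : a ⟶ b) (g : b ⟶ c) (i : Fin a.len) :
    (f ≫ g).map i = g.map (f.map i) := rfl

lemma DeltaTop.comp_map {a b c : DeltaTop.{u}} (f : a ⟶ b) (g : b ⟶ c) (i : Fin (a.top + 1)) :
    (f ≫ g).map i = g.map (f.map i) := rfl

lemma DeltaPlus.eqToHom_val {a b : DeltaPlus.{u}} (h : a = b) (i : Fin a.len) :
    ((eqToHom h).map i).val = i.val := by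
  subst h; rfl

lemma DeltaTop.eqToHom_val {a b : DeltaTop.{u}} (h : a = b) (i : Fin (a.top + 1)) :
    ((eqToHom h).map i).val = i.val := by
  subst h; rfl

/-- The ordinal sum functor `Δ₊ × Δ₊ ⥤ Δ₊`. -/
def sumPlus : DeltaPlus.{u} × DeltaPlus.{u} ⥤ DeltaPlus.{u} where
  obj x := ⟨x.1.len + x.2.len⟩
  map f := ⟨ordSum f.1.map f.2.map⟩
  map_id _ := DeltaPlus.Hom.ext (ordSum_id _ _)
  map_comp f g := DeltaPlus.Hom.ext (ordSum_comp f.1.map g.1.map f.2.map g.2.map)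

/-- The ordinal sum functor `Δ₊ × Δ[t] ⥤ Δ[t]`. -/
def sumTop : DeltaPlus.{u} × DeltaTop.{u} ⥤ DeltaTop.{u} where
  obj x := ⟨x.1.len + x.2.top⟩
  map {x y} f := ⟨(ordSum f.1.map f.2.map :
      Fin (x.1.len + (x.2.top + 1)) →o Fin (y.1.len + (y.2.top + 1))), by
    have h : Fin.last (x.1.len + x.2.top) = Fin.natAdd x.1.len (Fin.last x.2.top) := rfl
    have h' : Fin.last (y.1.len + y.2.top) = Fin.natAdd y.1.len (Fin.last y.2.top) := rfl
    rw [h, h', ← f.2.map_last]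
    exact ordSum_natAdd _ _ _⟩
  map_id _ := DeltaTop.Hom.ext (ordSum_id _ _)
  map_comp f g := DeltaTop.Hom.ext (ordSum_comp f.1.map g.1.map f.2.map g.2.map)

/-- The map of nerves induced by a functor of two variables. -/
def nerveMap₂ {C D E : Type u} [Category.{0} C] [Category.{0} D] [Category.{0} E]
    (F : C × D ⥤ E) : nerve C ⊗ nerve D ⟶ nerve E where
  app _ := ↾fun p => Functor.prod' p.1 p.2 ⋙ F

/-! ### The simplicial monoid `Δ₊` and its left module `Δ[t]` -/

/-- The simplicial set `Δ₊`. -/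
abbrev deltaPlus : SSet.{u} := nerve DeltaPlus.{u}

/-- The simplicial set `Δ[t]`. -/
abbrev deltaTop : SSet.{u} := nerve DeltaTop.{u}

lemma sumPlus_zero_left {J : Type} [Category.{0} J] (x : J ⥤ DeltaPlus.{u}) :
    Functor.prod' ((Functor.const J).obj ⟨0⟩) x ⋙ sumPlus = x := by
  refine CategoryTheory.Functor.ext (fun j => ?_) (fun j k f => DeltaPlus.hom_ext fun i => ?_)
  · exact congrArg DeltaPlus.mk (Nat.zero_add _)
  · rw [DeltaPlus.comp_map, DeltaPlus.comp_map, DeltaPlus.eqToHom_val]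
    refine (ordSum_val_of_ge _ _ i (Nat.zero_le _)).trans ?_
    refine (Nat.zero_add _).trans ?_
    refine congrArg (fun t => ((x.map f).map t).val) (Fin.ext ?_)
    exact (DeltaPlus.eqToHom_val _ i).symm

lemma sumPlus_zero_right {J : Type} [Category.{0} J] (x : J ⥤ DeltaPlus.{u}) :
    Functor.prod' x ((Functor.const J).obj ⟨0⟩) ⋙ sumPlus = x := by
  refine CategoryTheory.Functor.ext (fun j => rfl) (fun j k f => DeltaPlus.hom_ext fun i => ?_)
  rw [DeltaPlus.comp_map, DeltaPlus.comp_map, DeltaPlus.eqToHom_val]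
  exact ordSum_val_of_lt _ _ i i.isLt

lemma sumTop_zero_left {J : Type} [Category.{0} J] (x : J ⥤ DeltaTop.{u}) :
    Functor.prod' ((Functor.const J).obj ⟨0⟩) x ⋙ sumTop = x := by
  refine CategoryTheory.Functor.ext (fun j => ?_) (fun j k f => DeltaTop.hom_ext fun i => ?_)
  · exact congrArg DeltaTop.mk (Nat.zero_add _)
  · rw [DeltaTop.comp_map, DeltaTop.comp_map, DeltaTop.eqToHom_val]
    refine (ordSum_val_of_ge (OrderHom.id : Fin 0 →o Fin 0) (x.map f).map i (Nat.zero_le _)).trans ?_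
    refine (Nat.zero_add _).trans ?_
    refine congrArg (fun t => ((x.map f).map t).val) (Fin.ext ?_)
    exact (DeltaTop.eqToHom_val _ i).symm

lemma ordSum_assoc_val {a b c a' b' c' : ℕ} (f : Fin a →o Fin a') (g : Fin b →o Fin b')
    (h : Fin c →o Fin c') (i : Fin (a + b + c)) (j : Fin (a + (b + c))) (hij : i.val = j.val) :
    (ordSum (ordSum f g) h i).val = (ordSum f (ordSum g h) j).val := by
  have hi := i.isLt
  rcases lt_or_ge i.val a with h1 | h1
  · rw [ordSum_val_of_lt _ _ i (by lia), ordSum_val_of_lt _ _ _ h1,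
      ordSum_val_of_lt _ _ j (by lia)]
    simp only [hij]
  · rw [ordSum_val_of_ge f _ j (by lia)]
    rcases lt_or_ge i.val (a + b) with h2 | h2
    · rw [ordSum_val_of_lt _ _ i h2, ordSum_val_of_ge _ _ _ h1,
        ordSum_val_of_lt _ _ _ (show j.val - a < b by lia)]
      simp only [hij]
    · rw [ordSum_val_of_ge _ _ i h2,
        ordSum_val_of_ge _ _ _ (show b ≤ j.val - a by lia), Nat.add_assoc]
      simp only [hij, Nat.sub_sub]

lemma sumPlus_assoc {J : Type} [Category.{0} J] (x y z : J ⥤ DeltaPlus.{u}) :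
    Functor.prod' (Functor.prod' x y ⋙ sumPlus) z ⋙ sumPlus =
      Functor.prod' x (Functor.prod' y z ⋙ sumPlus) ⋙ sumPlus := by
  refine CategoryTheory.Functor.ext (fun j => ?_) (fun j k f => DeltaPlus.hom_ext fun i => ?_)
  · exact congrArg DeltaPlus.mk (Nat.add_assoc _ _ _)
  · rw [DeltaPlus.comp_map, DeltaPlus.comp_map, DeltaPlus.eqToHom_val]
    exact ordSum_assoc_val _ _ _ i _ (DeltaPlus.eqToHom_val _ _).symm

lemma sumTop_assoc {J : Type} [Category.{0} J] (x y : J ⥤ DeltaPlus.{u})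
    (z : J ⥤ DeltaTop.{u}) :
    Functor.prod' (Functor.prod' x y ⋙ sumPlus) z ⋙ sumTop =
      Functor.prod' x (Functor.prod' y z ⋙ sumTop) ⋙ sumTop := by
  refine CategoryTheory.Functor.ext (fun j => ?_) (fun j k f => DeltaTop.hom_ext fun i => ?_)
  · exact congrArg DeltaTop.mk (Nat.add_assoc _ _ _)
  · rw [DeltaTop.comp_map, DeltaTop.comp_map, DeltaTop.eqToHom_val]
    exact ordSum_assoc_val (x.map f).map (y.map f).map (z.map f).map i _ (DeltaTop.eqToHom_val _ _).symm

/-- The simplicial monoid `(Δ₊, ⊕, [-1])`. -/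
instance : MonObj deltaPlus.{u} where
  one := { app _ := ↾fun _ => (Functor.const _).obj ⟨0⟩ }
  mul := nerveMap₂ sumPlus
  one_mul := by
    ext k ⟨_, x⟩
    exact sumPlus_zero_left x
  mul_one := by
    ext k ⟨x, _⟩
    exact sumPlus_zero_right x
  mul_assoc := by
    ext k ⟨⟨x, y⟩, z⟩
    exact sumPlus_assoc x y z

/-- The left `Δ₊`-module `Δ[t]`, that is, the weight `W₋`. -/
instance : ModObj deltaPlus.{u} deltaTop.{u} where
  smul := nerveMap₂ sumTop
  one_smul := by
    ext k ⟨_, x⟩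
    exact sumTop_zero_left x
  mul_smul := by
    ext k ⟨⟨x, y⟩, z⟩
    exact sumTop_assoc x y z

/-! ### Homotopy coherent monads -/

/-- The object set of `Mnd`. -/
inductive Mnd : Type where
  | plus : Mnd

/-- The simplicial category `Mnd`: a single object, whose hom-space is `Δ₊`, with composition
`(g, f) ↦ g ⊕ f` (Mathlib's `comp` takes `f` first) and identity `[-1]`. -/
instance : EnrichedCategory SSet.{u} Mnd where
  Hom _ _ := deltaPlus
  id _ := MonObj.one
  comp _ _ _ := (β_ _ _).hom ≫ MonObj.mul
  id_comp _ _ := by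
    ext k x
    exact sumPlus_zero_right x
  comp_id _ _ := by
    ext k x
    exact sumPlus_zero_left x
  assoc _ _ _ _ := by
    ext k ⟨x, y, z⟩
    exact (sumPlus_assoc z y x).symm

/-- A (bundled) quasi-category. -/
structure QCat : Type (u + 1) where
  /-- the underlying simplicial set -/
  carrier : SSet.{u}
  [isQuasicategory : SSet.Quasicategory carrier]

attribute [instance] QCat.isQuasicategory

/-- The simplicial category of quasi-categories, a full simplicial subcategory of the cartesian
closed category of simplicial sets. -/
instance : EnrichedCategory SSet.{u} QCat.{u} where
  Hom A B := (ihom A.carrier).obj B.carrier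
  id A := MonoidalClosed.id A.carrier
  comp A B C := MonoidalClosed.comp A.carrier B.carrier C.carrier
  id_comp _ _ := MonoidalClosed.id_comp _ _
  comp_id _ _ := MonoidalClosed.comp_id _ _
  assoc _ _ _ _ := MonoidalClosed.assoc _ _ _ _

/-- A homotopy coherent monad: a simplicial functor from `Mnd` to the simplicial category of
quasi-categories. -/
abbrev HomotopyCoherentMonad := EnrichedFunctor SSet.{u} Mnd QCat.{u}

namespace HomotopyCoherentMonad

variable (T : HomotopyCoherentMonad.{u})

/-- The quasi-category on which the monad lives. -/
abbrev base : SSet.{u} := (T.obj Mnd.plus).carrier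

/-- The transpose `Δ₊ × A ⟶ A` of the action `Δ₊ ⟶ A ^ A` of `T` on hom-spaces. -/
noncomputable def action : deltaPlus ⊗ T.base ⟶ T.base :=
  (β_ _ _).hom ≫ MonoidalClosed.uncurry (T.map Mnd.plus Mnd.plus)

lemma uncurry_map_id :
    T.base ◁ (MonObj.one : 𝟙_ SSet.{u} ⟶ deltaPlus) ≫
      MonoidalClosed.uncurry (T.map Mnd.plus Mnd.plus) = (ρ_ _).hom := by
  have h := T.map_id Mnd.plus
  change (MonObj.one : 𝟙_ SSet.{u} ⟶ deltaPlus) ≫ _ = MonoidalClosed.id T.base at h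
  rw [← MonoidalClosed.uncurry_natural_left]
  refine (congrArg MonoidalClosed.uncurry h).trans ?_
  rw [MonoidalClosed.id_eq, MonoidalClosed.uncurry_curry]

lemma uncurry_map_comp :
    T.base ◁ ((β_ deltaPlus.{u} deltaPlus.{u}).hom ≫ MonObj.mul) ≫
        MonoidalClosed.uncurry (T.map Mnd.plus Mnd.plus) =
      (α_ _ _ _).inv ≫ MonoidalClosed.uncurry (T.map Mnd.plus Mnd.plus) ▷ _ ≫
        MonoidalClosed.uncurry (T.map Mnd.plus Mnd.plus) := by
  have h := T.map_comp Mnd.plus Mnd.plus Mnd.plus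
  change ((β_ deltaPlus.{u} deltaPlus.{u}).hom ≫ MonObj.mul) ≫ _ =
    _ ≫ MonoidalClosed.comp T.base T.base T.base at h
  rw [← MonoidalClosed.uncurry_natural_left]
  refine (congrArg MonoidalClosed.uncurry h).trans ?_
  rw [MonoidalClosed.uncurry_natural_left, MonoidalClosed.comp_eq, MonoidalClosed.uncurry_curry,
    MonoidalClosed.compTranspose_eq, MonoidalClosed.uncurry_eq]
  ext k x
  rfl

/-- The left action of the simplicial monoid `Δ₊` on the quasi-category `A` that corresponds to a
homotopy coherent monad on `A`. -/
noncomputable instance : ModObj deltaPlus.{u} T.base where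
  smul := T.action
  one_smul := by
    ext k ⟨o, a⟩
    exact types_congr_hom (NatTrans.congr_app T.uncurry_map_id k) (a, o)
  mul_smul := by
    ext k ⟨⟨m, m'⟩, a⟩
    exact types_congr_hom (NatTrans.congr_app T.uncurry_map_comp k) (a, m', m)

end HomotopyCoherentMonad

/-! ### The quasi-category of algebras -/

lemma stdSimplex_map_id (n : SimplexCategory) :
    SSet.stdSimplex.{u}.map (𝟙 n) = 𝟙 (SSet.stdSimplex.obj n) :=
  CategoryTheory.Functor.map_id _ _

lemma stdSimplex_map_comp {n k l : SimplexCategory} (f : n ⟶ k) (g : k ⟶ l) :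
    SSet.stdSimplex.{u}.map (f ≫ g) = SSet.stdSimplex.map f ≫ SSet.stdSimplex.map g :=
  CategoryTheory.Functor.map_comp _ _ _

lemma stdSimplex_map_id_simplex {n k : SimplexCategoryᵒᵖ} (θ : n ⟶ k) :
    (SSet.stdSimplex.{u}.obj n.unop).map θ (SSet.stdSimplex.objEquiv.symm (𝟙 n.unop)) =
      (SSet.stdSimplex.{u}.map θ.unop).app k (SSet.stdSimplex.objEquiv.symm (𝟙 k.unop)) :=
  rfl

lemma yonedaEquiv_map_comp {X : SSet.{u}} {n k : SimplexCategoryᵒᵖ} (θ : n ⟶ k)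
    (g : SSet.stdSimplex.{u}.obj n.unop ⟶ X) :
    SSet.yonedaEquiv (SSet.stdSimplex.map θ.unop ≫ g) = X.map θ (SSet.yonedaEquiv g) :=
  NatTrans.naturality_apply g θ (SSet.stdSimplex.objEquiv.symm (𝟙 n.unop))

section WeightedLimit

variable (W A : SSet.{u}) [ModObj deltaPlus.{u} W] [ModObj deltaPlus.{u} A]

variable {W A} in
/-- A map `X × W ⟶ A` is equivariant if it preserves the left action of `Δ₊`, where `Δ₊` acts on
the tensor `X × W` through `W`. -/
def IsEquivariant {X : SSet.{u}} (f : X ⊗ W ⟶ A) : Prop :=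
  ∀ (k : SimplexCategoryᵒᵖ) (m : deltaPlus.{u}.obj k) (x : X.obj k) (w : W.obj k),
    f.app k (x, (ModObj.smul (M := deltaPlus.{u}) (X := W)).app k (m, w)) =
      (ModObj.smul (M := deltaPlus.{u}) (X := A)).app k (m, f.app k (x, w))

variable {W A} in
lemma IsEquivariant.whiskerRight {X Y : SSet.{u}} {f : X ⊗ W ⟶ A} (hf : IsEquivariant f)
    (g : Y ⟶ X) : IsEquivariant (g ▷ W ≫ f) :=
  fun k m y w => hf k m (g.app k y) w

/-- The limit of (the simplicial functor on `Mnd` given by) `A` weighted by (that given by) `W`: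
its `n`-simplices are the equivariant maps `Δⁿ × W ⟶ A`. -/
def weightedLimit : SSet.{u} where
  obj n := {f : SSet.stdSimplex.{u}.obj n.unop ⊗ W ⟶ A // IsEquivariant f}
  map θ := ↾fun f => ⟨SSet.stdSimplex.map θ.unop ▷ W ≫ f.1, f.2.whiskerRight _⟩
  map_id n := by
    refine ConcreteCategory.hom_ext _ _ fun f => Subtype.ext ?_
    change SSet.stdSimplex.map (𝟙 n.unop) ▷ W ≫ f.1 = f.1
    rw [stdSimplex_map_id, id_whiskerRight, Category.id_comp]
  map_comp θ θ' := by
    refine ConcreteCategory.hom_ext _ _ fun f => Subtype.ext ?_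
    change SSet.stdSimplex.map (θ'.unop ≫ θ.unop) ▷ W ≫ f.1 =
      SSet.stdSimplex.map θ'.unop ▷ W ≫ SSet.stdSimplex.map θ.unop ▷ W ≫ f.1
    rw [stdSimplex_map_comp, comp_whiskerRight, Category.assoc]

variable {W} in
/-- The component of the limit cone of `weightedLimit W A` at a vertex `w` of the weight: it sends
`f : Δⁿ × W ⟶ A` to the simplex `f (-, w) : Δⁿ ⟶ A`. -/
def weightedLimitProj (w : W _⦋0⦌) : weightedLimit W A ⟶ A where
  app n := ↾fun f => SSet.yonedaEquiv
    (CartesianMonoidalCategory.lift (𝟙 (SSet.stdSimplex.obj n.unop)) (SSet.const w) ≫ f.1)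
  naturality n k θ := by
    refine ConcreteCategory.hom_ext _ _ fun f => ?_
    have h : CartesianMonoidalCategory.lift (𝟙 _) (SSet.const w) ≫
        SSet.stdSimplex.map θ.unop ▷ W ≫ f.1 =
        SSet.stdSimplex.map θ.unop ≫
          CartesianMonoidalCategory.lift (𝟙 _) (SSet.const w) ≫ f.1 := rfl
    refine (congrArg SSet.yonedaEquiv h).trans ?_
    exact yonedaEquiv_map_comp θ _

/-- The universal property of the weighted limit: maps `X ⟶ weightedLimit W A` correspond to
equivariant maps `X × W ⟶ A`. -/
def weightedLimitHomEquiv (X : SSet.{u}) :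
    (X ⟶ weightedLimit W A) ≃ {f : X ⊗ W ⟶ A // IsEquivariant f} where
  toFun h := ⟨{
      app k := ↾fun p => (h.app k p.1).1.app k (SSet.stdSimplex.objEquiv.symm (𝟙 k.unop), p.2)
      naturality k k' θ := by
        refine ConcreteCategory.hom_ext _ _ fun (p : X.obj k × W.obj k) => ?_
        have h₁ : h.app k' (X.map θ p.1) = (weightedLimit W A).map θ (h.app k p.1) :=
          NatTrans.naturality_apply h θ p.1
        let q : (SSet.stdSimplex.obj k.unop ⊗ W).obj k :=
          (SSet.stdSimplex.objEquiv.symm (𝟙 k.unop), p.2)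
        have h₂ := NatTrans.naturality_apply (h.app k p.1).1 θ q
        refine Eq.trans ?_ h₂
        change (h.app k' (X.map θ p.1)).1.app k'
          (SSet.stdSimplex.objEquiv.symm (𝟙 k'.unop), W.map θ p.2) = _
        rw [h₁]
        rfl },
    fun k m x w => (h.app k x).2 k m _ w⟩
  invFun f := {
    app n := ↾fun x => ⟨SSet.yonedaEquiv.symm x ▷ W ≫ f.1, f.2.whiskerRight _⟩
    naturality n k θ := by
      refine ConcreteCategory.hom_ext _ _ fun x => Subtype.ext ?_
      change SSet.yonedaEquiv.symm (X.map θ x) ▷ W ≫ f.1 =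
        SSet.stdSimplex.map θ.unop ▷ W ≫ SSet.yonedaEquiv.symm x ▷ W ≫ f.1
      have h : SSet.yonedaEquiv.symm (X.map θ x) =
        SSet.stdSimplex.map θ.unop ≫ SSet.yonedaEquiv.symm x := by
        rw [Equiv.symm_apply_eq, yonedaEquiv_map_comp, Equiv.apply_symm_apply]
      rw [h, comp_whiskerRight, Category.assoc] }
  left_inv h := by
    refine NatTrans.ext (funext fun n => ConcreteCategory.hom_ext _ _ fun x => Subtype.ext ?_)
    refine NatTrans.ext (funext fun k => ConcreteCategory.hom_ext _ _
      fun (p : (SSet.stdSimplex.obj n.unop).obj k × W.obj k) => ?_)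
    have h₁ : h.app k (X.map (SSet.stdSimplex.objEquiv p.1).op x) =
        (weightedLimit W A).map (SSet.stdSimplex.objEquiv p.1).op (h.app n x) :=
      NatTrans.naturality_apply h (SSet.stdSimplex.objEquiv p.1).op x
    change (h.app k (X.map (SSet.stdSimplex.objEquiv p.1).op x)).1.app k
      (SSet.stdSimplex.objEquiv.symm (𝟙 k.unop), p.2) = _
    rw [h₁]
    change (h.app n x).1.app k
      (SSet.stdSimplex.objEquiv.symm (𝟙 k.unop ≫ SSet.stdSimplex.objEquiv p.1), p.2) = _
    rw [Category.id_comp, Equiv.symm_apply_apply]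
  right_inv f := by
    refine Subtype.ext (NatTrans.ext (funext fun k => ConcreteCategory.hom_ext _ _
      fun (p : X.obj k × W.obj k) => ?_))
    change f.1.app k (X.map (𝟙 k) p.1, p.2) = f.1.app k p
    rw [Functor.map_id_apply]

end WeightedLimit

/-- The quasi-category of algebras `A[t]` of a homotopy coherent monad on `A`: the limit of the
monad weighted by `W₋ = Δ[t]`. -/
noncomputable abbrev algebras (T : HomotopyCoherentMonad.{u}) : SSet.{u} :=
  weightedLimit deltaTop.{u} T.base

/-- The forgetful functor `uᵗ : A[t] ⟶ A`: the component of the limit cone at `[0] ∈ Δ[t]`. -/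
noncomputable abbrev forgetful (T : HomotopyCoherentMonad.{u}) : algebras T ⟶ T.base :=
  weightedLimitProj T.base (ComposableArrows.mk₀ (⟨0⟩ : DeltaTop.{u}))

/-! ### Terminal objects -/

/-- The final vertex of `Δⁿ`. -/
def lastVertex (n : ℕ) : (Δ[n] : SSet.{u}) _⦋0⦌ :=
  SSet.stdSimplex.const n (Fin.last n) (op ⦋0⦌)

/-- The final vertex of `∂Δⁿ`, for `n ≥ 1`. -/
def boundaryLastVertex (n : ℕ) (hn : 1 ≤ n) : (∂Δ[n] : SSet.{u}) _⦋0⦌ :=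
  ⟨lastVertex n, by rw [SSet.boundary_obj_eq_univ 0 n hn]; trivial⟩

/-- A vertex `a` is terminal (in the sense of Joyal) if every sphere `∂Δⁿ ⟶ A` with `n ≥ 1` whose
final vertex is `a` has a filler. -/
def IsTerminalVertex {A : SSet.{u}} (a : A _⦋0⦌) : Prop :=
  ∀ (n : ℕ) (hn : 1 ≤ n) (s : (∂Δ[n] : SSet.{u}) ⟶ A),
    s.app (op ⦋0⦌) (boundaryLastVertex n hn) = a → ∃ σ : Δ[n] ⟶ A, ∂Δ[n].ι ≫ σ = s

/-- A map `p : E ⟶ B` creates terminal objects if every terminal object `b` of `B` lifts along `p`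
to an object of `E`, and every object of `E` lying over `b` is terminal in `E`. -/
def CreatesTerminal {E B : SSet.{u}} (p : E ⟶ B) : Prop :=
  ∀ b : B _⦋0⦌, IsTerminalVertex b →
    (∃ e : E _⦋0⦌, p.app (op ⦋0⦌) e = b) ∧
      ∀ e : E _⦋0⦌, p.app (op ⦋0⦌) e = b → IsTerminalVertex e

end HCMonad

/-!
The weight `Δ[t]` is a cell complex of free `Δ₊`-modules. Given a chain of ordinals and
top-preserving maps `y : [k₀] → ⋯ → [k_m]`, cut each `[k_i]` before the first element that is sent to
the top of `[k_m]`. This writes `y` as `m ⊕ y'`, with `m` a chain of finite ordinals and `y'`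
*reduced*, that is, ending in `[0]`; and such a decomposition is unique (`exists_eq_act`,
`eq_of_act_eq`). Hence an equivariant map `Δⁿ × Δ[t] ⟶ A` is determined by its values at the
simplices `(x, y)` with `y` reduced. The values at the nondegenerate ones may be chosen one after
the other, subject only to the boundary of each being the one already prescribed.

A map `∂Δⁿ ⟶ A[t]` and a compatible `Δⁿ ⟶ A` prescribe an equivariant map on
`∂Δⁿ × Δ[t] ∪ Δⁿ × (Δ₊ ⊕ [0])` (`initialGraph`). If a reduced simplex `(x, y)` is not in this
subcomplex, then `x` is surjective onto `Δⁿ`, so the last vertex of `(x, y)` is `(n, [0])`, which is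
sent to the terminal vertex `a`. The boundary of `(x, y)` is therefore a sphere in `A` with terminal
last vertex, and terminality fills it (`exists_filler`).

The transfinite bookkeeping is done with Zorn's lemma. A partial equivariant map is encoded by its
graph, a subcomplex of `Δⁿ × Δ[t] × A` (`IsPartialEquivariant`), and a maximal one is defined
everywhere (`exists_mem_of_maximal`): otherwise, a reduced simplex of least dimension at which it is
not defined is nondegenerate and has its boundary in the domain, and a cell can be adjoined
(`isPartialEquivariant_adjoinCell`). This gives the relative lifting property `exists_lift`, of
which the creation of terminal objects is a formal consequence.
-/

namespace HCMonad

/-! ### Diagrams of finite ordinals -/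

lemma DeltaPlus.ext {a b : DeltaPlus.{u}} (h : a.len = b.len) : a = b := by
  cases a; cases b; cases h; rfl

lemma DeltaTop.ext {a b : DeltaTop.{u}} (h : a.top = b.top) : a = b := by
  cases a; cases b; cases h; rfl

lemma DeltaPlus.functor_ext {J : Type} [Category.{0} J] {F G : J ⥤ DeltaPlus.{u}}
    (hobj : ∀ j, (F.obj j).len = (G.obj j).len)
    (hmap : ∀ {j j' : J} (f : j ⟶ j') (i : Fin (F.obj j).len) (i' : Fin (G.obj j).len),
      i.val = i'.val → ((F.map f).map i).val = ((G.map f).map i').val) : F = G := by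
  refine CategoryTheory.Functor.ext (fun j => DeltaPlus.ext (hobj j))
    (fun j k f => DeltaPlus.hom_ext fun i => ?_)
  rw [DeltaPlus.comp_map, DeltaPlus.comp_map, DeltaPlus.eqToHom_val]
  exact hmap f _ _ (DeltaPlus.eqToHom_val _ _).symm

lemma DeltaTop.functor_ext {J : Type} [Category.{0} J] {F G : J ⥤ DeltaTop.{u}}
    (hobj : ∀ j, (F.obj j).top = (G.obj j).top)
    (hmap : ∀ {j j' : J} (f : j ⟶ j') (i : Fin ((F.obj j).top + 1))
      (i' : Fin ((G.obj j).top + 1)),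
      i.val = i'.val → ((F.map f).map i).val = ((G.map f).map i').val) : F = G := by
  refine CategoryTheory.Functor.ext (fun j => DeltaTop.ext (hobj j))
    (fun j k f => DeltaTop.hom_ext fun i => ?_)
  rw [DeltaTop.comp_map, DeltaTop.comp_map, DeltaTop.eqToHom_val]
  exact hmap f _ _ (DeltaTop.eqToHom_val _ _).symm

lemma DeltaTop.functor_map_val_congr {J : Type} [Category.{0} J] {F G : J ⥤ DeltaTop.{u}}
    (h : F = G) {j j' : J} (f : j ⟶ j') (i : Fin ((F.obj j).top + 1))
    (i' : Fin ((G.obj j).top + 1)) (hi : i.val = i'.val) :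
    ((F.map f).map i).val = ((G.map f).map i').val := by
  subst h
  rw [Fin.ext hi]

section

variable {J : Type} [Category.{0} J]

/-- The pointwise ordinal sum `m ⊕ y` of diagrams of finite ordinals. -/
abbrev sumDiagram (m : J ⥤ DeltaPlus.{u}) (y : J ⥤ DeltaTop.{u}) : J ⥤ DeltaTop.{u} :=
  Functor.prod' m y ⋙ sumTop

lemma sumDiagram_map_val_of_lt (m : J ⥤ DeltaPlus.{u}) (y : J ⥤ DeltaTop.{u}) {j j' : J}
    (f : j ⟶ j') (i : Fin (((sumDiagram m y).obj j).top + 1)) (h : i.val < (m.obj j).len) :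
    (((sumDiagram m y).map f).map i).val = ((m.map f).map ⟨i.val, h⟩).val :=
  ordSum_val_of_lt (m.map f).map (y.map f).map i h

lemma sumDiagram_map_val_of_ge (m : J ⥤ DeltaPlus.{u}) (y : J ⥤ DeltaTop.{u}) {j j' : J}
    (f : j ⟶ j') (i : Fin (((sumDiagram m y).obj j).top + 1)) (h : (m.obj j).len ≤ i.val)
    (i' : Fin ((y.obj j).top + 1)) (hi' : i'.val = i.val - (m.obj j).len) :
    (((sumDiagram m y).map f).map i).val = (m.obj j').len + ((y.map f).map i').val := by
  refine (ordSum_val_of_ge (m.map f).map (y.map f).map i h).trans ?_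
  exact congrArg (fun i => (m.obj j').len + ((y.map f).map i).val) (Fin.ext hi'.symm)

variable {m m' : J ⥤ DeltaPlus.{u}} {y y' : J ⥤ DeltaTop.{u}} {t : J}

/-- The first summand of a diagram `m ⊕ y` that ends in `m ⊕ [0]` consists of the elements that
are not sent to the top element of the last ordinal. -/
lemma len_le_of_sumDiagram_eq (h : sumDiagram m y = sumDiagram m' y')
    (hy : (y.obj t).top = 0) (hy' : (y'.obj t).top = 0) {j : J} (f : j ⟶ t) :
    (m.obj j).len ≤ (m'.obj j).len := by
  by_contra! hlt
  have hj : (m.obj j).len + (y.obj j).top = (m'.obj j).len + (y'.obj j).top :=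
    congrArg (fun F => (F.obj j).top) h
  have ht : (m.obj t).len + (y.obj t).top = (m'.obj t).len + (y'.obj t).top :=
    congrArg (fun F => (F.obj t).top) h
  have h1 := sumDiagram_map_val_of_lt m y f
    ⟨(m'.obj j).len, show _ < (m.obj j).len + (y.obj j).top + 1 by lia⟩ hlt
  have h2 := sumDiagram_map_val_of_ge m' y' f
    ⟨(m'.obj j).len, show _ < (m'.obj j).len + (y'.obj j).top + 1 by lia⟩ le_rfl 0 (by simp)
  have h3 := DeltaTop.functor_map_val_congr h f
    ⟨(m'.obj j).len, show _ < (m.obj j).len + (y.obj j).top + 1 by lia⟩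
    ⟨(m'.obj j).len, show _ < (m'.obj j).len + (y'.obj j).top + 1 by lia⟩ rfl
  have h4 := ((m.map f).map ⟨(m'.obj j).len, hlt⟩).isLt
  simp only at h1
  lia

/-- A decomposition `m ⊕ y` with last ordinal of `y` equal to `[0]` is unique. -/
lemma sumDiagram_injective (ht : ∀ j : J, Nonempty (j ⟶ t)) (h : sumDiagram m y = sumDiagram m' y')
    (hy : (y.obj t).top = 0) (hy' : (y'.obj t).top = 0) : m = m' ∧ y = y' := by
  have hm : ∀ j, (m.obj j).len = (m'.obj j).len := fun j =>
    le_antisymm (len_le_of_sumDiagram_eq h hy hy' (ht j).some)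
      (len_le_of_sumDiagram_eq h.symm hy' hy (ht j).some)
  have hy : ∀ j, (y.obj j).top = (y'.obj j).top := fun j => by
    have hj : (m.obj j).len + (y.obj j).top = (m'.obj j).len + (y'.obj j).top :=
      congrArg (fun F => (F.obj j).top) h
    have := hm j
    lia
  refine ⟨DeltaPlus.functor_ext hm fun {j j'} f i i' hi => ?_,
    DeltaTop.functor_ext hy fun {j j'} f i i' hi => ?_⟩
  · have h1 := sumDiagram_map_val_of_lt m y f
      ⟨i, show _ < (m.obj j).len + (y.obj j).top + 1 by lia⟩ i.isLt
    have h2 := sumDiagram_map_val_of_lt m' y' f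
      ⟨i', show _ < (m'.obj j).len + (y'.obj j).top + 1 by lia⟩ i'.isLt
    exact h1.symm.trans ((DeltaTop.functor_map_val_congr h f _ _ hi).trans h2)
  · have h1 := sumDiagram_map_val_of_ge m y f
      ⟨(m.obj j).len + i, show _ < (m.obj j).len + (y.obj j).top + 1 by lia⟩ (by simp) i (by simp)
    have h2 := sumDiagram_map_val_of_ge m' y' f
      ⟨(m'.obj j).len + i', show _ < (m'.obj j).len + (y'.obj j).top + 1 by lia⟩ (by simp) i'
      (by simp)
    have h3 := DeltaTop.functor_map_val_congr h f
      ⟨(m.obj j).len + i, show _ < (m.obj j).len + (y.obj j).top + 1 by lia⟩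
      ⟨(m'.obj j).len + i', show _ < (m'.obj j).len + (y'.obj j).top + 1 by lia⟩
      (by simp [hm j, hi])
    have := hm j'
    lia

/-- A cut of a diagram of ordinals, compatible with all its maps, decomposes the diagram as an
ordinal sum. -/
lemma exists_sumDiagram_of_cut (z : J ⥤ DeltaTop.{u}) (c : J → ℕ) (hc : ∀ j, c j ≤ (z.obj j).top)
    (hcut : ∀ {j j' : J} (f : j ⟶ j') (i : Fin ((z.obj j).top + 1)),
      ((z.map f).map i).val < c j' ↔ i.val < c j) :
    ∃ (m : J ⥤ DeltaPlus.{u}) (y : J ⥤ DeltaTop.{u}),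
      sumDiagram m y = z ∧ ∀ j, (m.obj j).len = c j := by
  let m : J ⥤ DeltaPlus.{u} :=
    { obj j := ⟨c j⟩
      map {j j'} f := ⟨
        { toFun i := ⟨((z.map f).map ⟨i.val, by have := hc j; lia⟩).val, (hcut f _).2 i.isLt⟩
          monotone' i i' h := (z.map f).map.monotone h }⟩
      map_id j := DeltaPlus.hom_ext fun i => by
        change ((z.map (𝟙 j)).map _).val = _
        rw [z.map_id]; rfl
      map_comp f g := DeltaPlus.hom_ext fun i => by
        change ((z.map (f ≫ g)).map _).val = _
        rw [z.map_comp]; rfl }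
  let y : J ⥤ DeltaTop.{u} :=
    { obj j := ⟨(z.obj j).top - c j⟩
      map {j j'} f := ⟨
        { toFun i := ⟨((z.map f).map ⟨c j + i.val, by have := hc j; lia⟩).val - c j', by
            have := hc j'; lia⟩
          monotone' i i' h := Nat.sub_le_sub_right ((z.map f).map.monotone
            (show c j + i.val ≤ c j + i'.val from Nat.add_le_add_left h _)) _ }, by
        have h := congrArg Fin.val (z.map f).map_last
        have h1 : (⟨c j + ((z.obj j).top - c j), by have := hc j; lia⟩ : Fin ((z.obj j).top + 1)) =
          Fin.last _ := Fin.ext (by have := hc j; simp; lia)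
        exact Fin.ext (congrArg (· - c j') ((congrArg (fun i => ((z.map f).map i).val) h1).trans h))⟩
      map_id j := DeltaTop.hom_ext fun i => by
        change ((z.map (𝟙 j)).map _).val - _ = _
        rw [z.map_id]
        exact Nat.add_sub_cancel_left ..
      map_comp {j j' j''} f g := DeltaTop.hom_ext fun i => by
        change ((z.map (f ≫ g)).map _).val - _ = ((z.map g).map ⟨c j' + (_ - c j'), _⟩).val - _
        rw [z.map_comp, DeltaTop.comp_map]
        congr 4
        refine Fin.ext ?_
        have := (hcut f ⟨c j + i.val, by have := hc j; lia⟩).not.2 (by simp)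
        simp only
        lia }
  refine ⟨m, y, DeltaTop.functor_ext (fun j => Nat.add_sub_of_le (hc j))
    fun {j j'} f i i' hi => ?_, fun _ => rfl⟩
  rcases lt_or_ge i.val (c j) with h | h
  · refine (sumDiagram_map_val_of_lt m y f i h).trans ?_
    exact congrArg (fun i => ((z.map f).map i).val) (Fin.ext hi)
  · refine (sumDiagram_map_val_of_ge m y f i h ⟨i.val - c j, ?_⟩ rfl).trans ?_
    · have := i'.isLt
      change _ < (z.obj j).top - c j + 1
      lia
    · have h1 : (⟨c j + (i.val - c j), by have := i'.isLt; lia⟩ : Fin ((z.obj j).top + 1)) = i' :=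
        Fin.ext (by simp; lia)
      have h2 := (hcut f i').not.2 (by lia)
      change c j' + (((z.map f).map ⟨c j + (i.val - c j), _⟩).val - c j') = _
      rw [h1]
      lia

/-- Every diagram `z` of ordinals with a last ordinal is an ordinal sum `m ⊕ y` in which the last
ordinal of `y` is `[0]`: cut each ordinal before the elements that are sent to the last top. -/
lemma exists_sumDiagram [Quiver.IsThin J] (ht : ∀ j : J, Nonempty (j ⟶ t))
    (z : J ⥤ DeltaTop.{u}) :
    ∃ (m : J ⥤ DeltaPlus.{u}) (y : J ⥤ DeltaTop.{u}),
      sumDiagram m y = z ∧ (y.obj t).top = 0 := by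
  have hcut : ∀ j : J, ∃ c ≤ (z.obj j).top, ∀ i : Fin ((z.obj j).top + 1),
      i.val < c ↔ ((z.map (ht j).some).map i).val < (z.obj t).top := fun j => by
    classical
    let S := Finset.univ.filter fun i => (z.map (ht j).some).map i = Fin.last _
    have hS : S.Nonempty := ⟨Fin.last _, by simp [S, (z.map (ht j).some).map_last]⟩
    have h1 : ∀ i, i < S.min' hS ↔ (z.map (ht j).some).map i ≠ Fin.last _ := fun i => by
      refine ⟨fun hi h => hi.not_ge (S.min'_le i (by simp [S, h])), fun h => ?_⟩
      by_contra! h'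
      have h2 : (z.map (ht j).some).map (S.min' hS) = Fin.last _ := by
        simpa [S] using S.min'_mem hS
      exact h (top_unique (h2.ge.trans ((z.map (ht j).some).map.monotone h')))
    refine ⟨S.min' hS, Nat.lt_succ_iff.1 (S.min' hS).isLt, fun i => ?_⟩
    rw [← Fin.lt_def, h1, ← Fin.lt_last_iff_ne_last, Fin.lt_def, Fin.val_last]
  choose c hc hc' using hcut
  obtain ⟨m, y, rfl, hm⟩ := exists_sumDiagram_of_cut z c hc fun {j j'} f i => by
    rw [hc', hc', ← DeltaTop.comp_map, ← z.map_comp]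
    exact iff_of_eq (congrArg (fun g => ((z.map g).map i).val < (z.obj t).top)
      (Subsingleton.elim _ _))
  refine ⟨m, y, rfl, ?_⟩
  have h1 := (hc' t ⟨(m.obj t).len, Nat.lt_succ_of_le (Nat.le_add_right _ _)⟩).not.1
    (by simp [hm])
  have h2 : (ht t).some = 𝟙 t := Subsingleton.elim _ _
  rw [h2, (sumDiagram m y).map_id t] at h1
  have h3 : ¬ (m.obj t).len < (m.obj t).len + (y.obj t).top := h1
  lia

end

/-! ### Reduced simplices of the weight -/

section

variable {W : SSet.{u}} [ModObj deltaPlus.{u} W]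

/-- The action of a simplex of `Δ₊` on a simplex of a left `Δ₊`-module. -/
def act {k : SimplexCategoryᵒᵖ} (m : deltaPlus.{u}.obj k) (w : W.obj k) : W.obj k :=
  (ModObj.smul (M := deltaPlus.{u}) (X := W)).app k (m, w)

lemma map_act {k k' : SimplexCategoryᵒᵖ} (θ : k ⟶ k') (m : deltaPlus.{u}.obj k) (w : W.obj k) :
    W.map θ (act m w) = act (deltaPlus.{u}.map θ m) (W.map θ w) :=
  (types_congr_hom ((ModObj.smul (M := deltaPlus.{u}) (X := W)).naturality θ) (m, w)).symm

lemma act_one {k : SimplexCategoryᵒᵖ} (w : W.obj k) :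
    act ((MonObj.one (X := deltaPlus.{u})).app k PUnit.unit) w = w :=
  types_congr_hom (NatTrans.congr_app (ModObj.one_smul (M := deltaPlus.{u}) (X := W)) k)
    (PUnit.unit, w)

lemma act_mul {k : SimplexCategoryᵒᵖ} (m m' : deltaPlus.{u}.obj k) (w : W.obj k) :
    act ((MonObj.mul (X := deltaPlus.{u})).app k (m, m')) w = act m (act m' w) :=
  types_congr_hom (NatTrans.congr_app (ModObj.mul_smul (M := deltaPlus.{u}) (X := W)) k)
    ((m, m'), w)

end

/-- A simplex of `Δ[t]` is reduced if its last vertex is `[0]`. -/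
def IsReduced {k : SimplexCategoryᵒᵖ} (y : deltaTop.{u}.obj k) : Prop :=
  (ComposableArrows.right y).top = 0

lemma IsReduced.map {k k' : SimplexCategory} {y : deltaTop.{u}.obj (op k)} (hy : IsReduced y)
    (θ : k' ⟶ k) [Epi θ] : IsReduced (deltaTop.{u}.map θ.op y) := by
  have h : θ.toOrderHom (Fin.last _) = Fin.last _ := by
    obtain ⟨i, hi⟩ := SimplexCategory.epi_iff_surjective.1 ‹Epi θ› (Fin.last _)
    exact top_unique (hi.ge.trans (θ.toOrderHom.monotone (Fin.le_last i)))
  change (y.obj (θ.toOrderHom (Fin.last _))).top = 0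
  rw [h]
  exact hy

lemma eq_of_act_eq {k : SimplexCategoryᵒᵖ} {m m' : deltaPlus.{u}.obj k} {y y' : deltaTop.{u}.obj k}
    (h : act m y = act m' y') (hy : IsReduced y) (hy' : IsReduced y') : m = m' ∧ y = y' :=
  sumDiagram_injective (t := Fin.last _) (fun j => ⟨homOfLE (Fin.le_last j)⟩) h hy hy'

lemma exists_eq_act {k : SimplexCategoryᵒᵖ} (z : deltaTop.{u}.obj k) :
    ∃ (m : deltaPlus.{u}.obj k) (y : deltaTop.{u}.obj k), z = act m y ∧ IsReduced y := by
  obtain ⟨m, y, h, hy⟩ :=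
    exists_sumDiagram (t := Fin.last _) (fun j => ⟨homOfLE (Fin.le_last j)⟩) z
  exact ⟨m, y, h.symm, hy⟩

/-! ### Partial equivariant maps -/

variable {X A : SSet.{u}}

lemma map_mem (Γ : (X ⊗ deltaTop.{u} ⊗ A).Subcomplex) {k k' : SimplexCategoryᵒᵖ} (θ : k ⟶ k')
    {x : X.obj k} {y : deltaTop.{u}.obj k} {b : A.obj k} (h : (x, y, b) ∈ Γ.obj k) :
    (X.map θ x, deltaTop.{u}.map θ y, A.map θ b) ∈ Γ.obj k' :=
  Γ.map θ h

variable [ModObj deltaPlus.{u} A]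

/-- A subcomplex of `X × Δ[t] × A` that is the graph of an equivariant map to `A` defined on a
subcomplex of `X × Δ[t]`. That subcomplex is required to contain `(x, y)` as soon as it contains
`(x, m ⊕ y)`; thus it is determined by those of its simplices `(x, y)` with `y` reduced. -/
structure IsPartialEquivariant (Γ : (X ⊗ deltaTop.{u} ⊗ A).Subcomplex) : Prop where
  functional {k : SimplexCategoryᵒᵖ} {x : X.obj k} {y : deltaTop.{u}.obj k} {b b' : A.obj k} :
    (x, y, b) ∈ Γ.obj k → (x, y, b') ∈ Γ.obj k → b = b'
  act_mem {k : SimplexCategoryᵒᵖ} {x : X.obj k} {y : deltaTop.{u}.obj k} {b : A.obj k}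
    (m : deltaPlus.{u}.obj k) : (x, y, b) ∈ Γ.obj k → (x, act m y, act m b) ∈ Γ.obj k
  saturated {k : SimplexCategoryᵒᵖ} {x : X.obj k} {y : deltaTop.{u}.obj k} {b : A.obj k}
    {m : deltaPlus.{u}.obj k} : (x, act m y, b) ∈ Γ.obj k → ∃ b', (x, y, b') ∈ Γ.obj k

/-- The simplices obtained from the simplex `(x, y, τ)` by surjective simplicial operators and the
action of `Δ₊`, adjoined to a subcomplex that contains the boundary of `(x, y, τ)`. -/
def adjoinCell (Γ : (X ⊗ deltaTop.{u} ⊗ A).Subcomplex) (hΓ : IsPartialEquivariant Γ) {N : ℕ}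
    (x : X _⦋N⦌) (y : deltaTop.{u} _⦋N⦌) (τ : A _⦋N⦌)
    (hτ : ∀ (k : SimplexCategory) (θ : k ⟶ ⦋N⦌), ¬ Epi θ →
      (X.map θ.op x, deltaTop.{u}.map θ.op y, A.map θ.op τ) ∈ Γ.obj (op k)) :
    (X ⊗ deltaTop.{u} ⊗ A).Subcomplex where
  obj k := Γ.obj k ∪ Set.ofPred (fun p => ∃ (θ : k.unop ⟶ ⦋N⦌) (m : deltaPlus.{u}.obj k), Epi θ ∧
    p.1 = X.map θ.op x ∧ p.2.1 = act m (deltaTop.{u}.map θ.op y) ∧ p.2.2 = act m (A.map θ.op τ))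
  map {k k'} φ := by
    rintro ⟨x', y', b⟩ (h | ⟨θ, m, hθ, h₁, h₂, h₃⟩)
    · exact Or.inl (Γ.map φ h)
    · have h₁' : X.map φ x' = X.map (φ.unop ≫ θ).op x :=
        (congrArg _ h₁).trans (X.map_comp_apply θ.op φ x).symm
      have h₂' : deltaTop.{u}.map φ y' =
          act (deltaPlus.{u}.map φ m) (deltaTop.{u}.map (φ.unop ≫ θ).op y) :=
        (congrArg _ h₂).trans (map_act φ m _)
      have h₃' : A.map φ b = act (deltaPlus.{u}.map φ m) (A.map (φ.unop ≫ θ).op τ) :=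
        (congrArg _ h₃).trans ((map_act φ m _).trans
          (congrArg (act _) (A.map_comp_apply θ.op φ τ).symm))
      by_cases hφ : Epi (φ.unop ≫ θ)
      · exact Or.inr ⟨_, _, hφ, h₁', h₂', h₃'⟩
      · have h : (X.map φ x', deltaTop.{u}.map φ y', A.map φ b) ∈ Γ.obj k' := by
          rw [h₁', h₂', h₃']
          exact hΓ.act_mem _ (hτ _ _ hφ)
        exact Or.inl h

section

variable {Γ : (X ⊗ deltaTop.{u} ⊗ A).Subcomplex} {hΓ : IsPartialEquivariant Γ} {N : ℕ}
  {x : X _⦋N⦌} {y : deltaTop.{u} _⦋N⦌} {τ : A _⦋N⦌}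
  {hτ : ∀ (k : SimplexCategory) (θ : k ⟶ ⦋N⦌), ¬ Epi θ →
    (X.map θ.op x, deltaTop.{u}.map θ.op y, A.map θ.op τ) ∈ Γ.obj (op k)}

lemma le_adjoinCell : Γ ≤ adjoinCell Γ hΓ x y τ hτ := fun _ _ h => Or.inl h

lemma mem_adjoinCell : (x, y, τ) ∈ (adjoinCell Γ hΓ x y τ hτ).obj (op ⦋N⦌) := by
  refine Or.inr ⟨𝟙 _, (MonObj.one (X := deltaPlus.{u})).app _ PUnit.unit, inferInstance, ?_, ?_, ?_⟩
  · exact (X.map_id_apply _ x).symm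
  · exact (act_one y).symm
  · exact ((act_one _).trans (A.map_id_apply _ τ)).symm

/-- If `(x, y)` is not in the domain of `Γ`, no degeneracy of it is, nor any translate of one: a
section of the surjective operator `θ` would bring `(x, y)` back into the domain. -/
lemma notMem_of_epi (hΓ : IsPartialEquivariant Γ) (hxy : ∀ b, (x, y, b) ∉ Γ.obj (op ⦋N⦌))
    {k : SimplexCategory} (θ : k ⟶ ⦋N⦌) [Epi θ] (m : deltaPlus.{u}.obj (op k)) (b : A.obj (op k)) :
    (X.map θ.op x, act m (deltaTop.{u}.map θ.op y), b) ∉ Γ.obj (op k) := by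
  intro h
  obtain ⟨b', h'⟩ := hΓ.saturated h
  obtain ⟨s⟩ := (isSplitEpi_of_epi θ).exists_splitEpi
  have h2 := map_mem Γ s.section_.op h'
  have hs : θ.op ≫ s.section_.op = 𝟙 _ := by rw [← op_comp, s.id]; rfl
  rw [← X.map_comp_apply, ← deltaTop.{u}.map_comp_apply, hs, X.map_id_apply,
    deltaTop.{u}.map_id_apply] at h2
  exact hxy _ h2

/-- Adjoining a cell extends a partial equivariant map. Since the decomposition of simplices of
`Δ[t]` is unique, and a simplex is in a unique way a degeneracy of a nondegenerate one, the value
of the extension at each new simplex is well defined. -/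
lemma isPartialEquivariant_adjoinCell (hy : IsReduced y)
    (hnd : (x, y) ∈ (X ⊗ deltaTop.{u}).nonDegenerate N)
    (hxy : ∀ b, (x, y, b) ∉ Γ.obj (op ⦋N⦌)) :
    IsPartialEquivariant (adjoinCell Γ hΓ x y τ hτ) where
  functional {k x' y' b b'} h h' := by
    rcases h with h | ⟨θ, m, hθ, rfl, rfl, rfl⟩ <;>
      rcases h' with h' | ⟨θ', m', hθ', h₁, h₂, rfl⟩
    · exact hΓ.functional h h'
    · obtain rfl : x' = _ := h₁
      obtain rfl : y' = _ := h₂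
      exact (notMem_of_epi hΓ hxy _ _ _ h).elim
    · exact (notMem_of_epi hΓ hxy _ _ _ h').elim
    · obtain ⟨rfl, h₃⟩ := eq_of_act_eq h₂ (hy.map θ) (hy.map θ')
      have : θ = θ' := by
        obtain ⟨⟨k⟩⟩ := k
        exact SSet.unique_nonDegenerate_map (X ⊗ deltaTop.{u}) (m := N)
          ((X ⊗ deltaTop.{u}).map θ.op (x, y)) θ ⟨_, hnd⟩ rfl θ' ⟨_, hnd⟩ (Prod.ext h₁ h₃)
      rw [this]
  act_mem {k x' y' b} m' h := by
    rcases h with h | ⟨θ, m, hθ, rfl, rfl, rfl⟩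
    · exact Or.inl (hΓ.act_mem m' h)
    · exact Or.inr ⟨θ, (MonObj.mul (X := deltaPlus.{u})).app k (m', m), hθ, rfl,
        (act_mul _ _ _).symm, (act_mul _ _ _).symm⟩
  saturated {k x' y' b m'} h := by
    rcases h with h | ⟨θ, m, hθ, rfl, h₂, rfl⟩
    · obtain ⟨b', h'⟩ := hΓ.saturated h
      exact ⟨b', Or.inl h'⟩
    · obtain ⟨m'', y'', rfl, hy''⟩ := exists_eq_act y'
      obtain ⟨-, rfl⟩ := eq_of_act_eq ((act_mul _ _ _).trans h₂) hy'' (hy.map θ)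
      exact ⟨_, Or.inr ⟨θ, m'', hθ, rfl, rfl, rfl⟩⟩

end

lemma exists_maximal {Γ : (X ⊗ deltaTop.{u} ⊗ A).Subcomplex} (hΓ : IsPartialEquivariant Γ) :
    ∃ Γ', Γ ≤ Γ' ∧ Maximal IsPartialEquivariant Γ' := by
  refine zorn_le_nonempty₀ {Γ | IsPartialEquivariant Γ} (fun c hc hchain Γ₀ hΓ₀ => ?_) Γ hΓ
  have hmem : ∀ {k : SimplexCategoryᵒᵖ} (p : (X ⊗ deltaTop.{u} ⊗ A).obj k),
      p ∈ (sSup c).obj k ↔ ∃ Γ ∈ c, p ∈ Γ.obj k := fun p => by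
    constructor
    · rintro ⟨_, ⟨Γ, h, rfl⟩, h'⟩
      exact ⟨Γ, h, h'⟩
    · rintro ⟨Γ, h, h'⟩
      exact ⟨_, ⟨Γ, h, rfl⟩, h'⟩
  refine ⟨sSup c, ⟨fun {k x y b b'} h h' => ?_, fun {k x y b} m h => ?_, fun {k x y b m} h => ?_⟩,
    fun Γ hΓ => le_sSup hΓ⟩
  · obtain ⟨Γ₁, h₁, h⟩ := (hmem _).1 h
    obtain ⟨Γ₂, h₂, h'⟩ := (hmem _).1 h'
    rcases hchain.total h₁ h₂ with h₁₂ | h₁₂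
    · exact (hc h₂).functional (h₁₂ _ h) h'
    · exact (hc h₁).functional h (h₁₂ _ h')
  · obtain ⟨Γ₁, h₁, h⟩ := (hmem _).1 h
    exact (hmem _).2 ⟨Γ₁, h₁, (hc h₁).act_mem m h⟩
  · obtain ⟨Γ₁, h₁, h⟩ := (hmem _).1 h
    obtain ⟨b', h'⟩ := (hc h₁).saturated h
    exact ⟨b', (hmem _).2 ⟨Γ₁, h₁, h'⟩⟩

/-- The `k`-simplex of `Δ[t]` that is constant at `[0]`. -/
abbrev zeroSimplex (k : SimplexCategoryᵒᵖ) : deltaTop.{u}.obj k :=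
  deltaTop.{u}.map (k.unop.const ⦋0⦌ 0).op (ComposableArrows.mk₀ (⟨0⟩ : DeltaTop.{u}))

lemma isReduced_zeroSimplex (k : SimplexCategoryᵒᵖ) : IsReduced (zeroSimplex.{u} k) := rfl

/-- The last vertex `⦋0⦌ ⟶ ⦋k⦌`. -/
abbrev lastHom (k : SimplexCategory) : ⦋0⦌ ⟶ k := ⦋0⦌.const k (Fin.last _)

lemma IsReduced.map_lastHom {k : SimplexCategory} {y : deltaTop.{u}.obj (op k)}
    (hy : IsReduced y) : deltaTop.{u}.map (lastHom k).op y = zeroSimplex (op ⦋0⦌) :=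
  ComposableArrows.ext₀ (DeltaTop.ext hy)

/-! ### Extension to all of `X × Δ[t]` -/

/-- The sphere that a partial equivariant map `Γ` defined on the boundary of a simplex `(x, y)` yields
in `A` can be filled if its last vertex is terminal. -/
lemma exists_filler {Γ : (X ⊗ deltaTop.{u} ⊗ A).Subcomplex} (hΓ : IsPartialEquivariant Γ)
    {a : A _⦋0⦌} (ha : IsTerminalVertex a) {N : ℕ} (hN : 1 ≤ N) (x : X _⦋N⦌)
    (y : deltaTop.{u} _⦋N⦌)
    (hdom : ∀ (k : SimplexCategory) (θ : k ⟶ ⦋N⦌), ¬ Epi θ →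
      ∃ b, (X.map θ.op x, deltaTop.{u}.map θ.op y, b) ∈ Γ.obj (op k))
    (hlast : (X.map (lastHom ⦋N⦌).op x, deltaTop.{u}.map (lastHom ⦋N⦌).op y, a) ∈
      Γ.obj (op ⦋0⦌)) :
    ∃ τ : A _⦋N⦌, ∀ (k : SimplexCategory) (θ : k ⟶ ⦋N⦌), ¬ Epi θ →
      (X.map θ.op x, deltaTop.{u}.map θ.op y, A.map θ.op τ) ∈ Γ.obj (op k) := by
  have hepi : ∀ {k : SimplexCategoryᵒᵖ} (s : (∂Δ[N] : SSet.{u}).obj k),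
      ¬ Epi (SSet.stdSimplex.objEquiv s.1) := fun {k} s h =>
    s.2 (SimplexCategory.epi_iff_surjective.1 h)
  have hdom' : ∀ (k : SimplexCategoryᵒᵖ) (s : (∂Δ[N] : SSet.{u}).obj k),
      ∃ b : A.obj k, (X.map (SSet.stdSimplex.objEquiv s.1).op x,
        deltaTop.{u}.map (SSet.stdSimplex.objEquiv s.1).op y, b) ∈ Γ.obj k :=
    fun k s => hdom _ _ (hepi s)
  choose g hg using hdom'
  let s : (∂Δ[N] : SSet.{u}) ⟶ A :=
    { app k := ↾fun s => g k s
      naturality k k' θ := by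
        refine ConcreteCategory.hom_ext _ _ fun s => hΓ.functional (hg k' _) ?_
        have h := map_mem Γ θ (hg k s)
        rw [← X.map_comp_apply, ← deltaTop.{u}.map_comp_apply] at h
        exact h }
  obtain ⟨σ, hσ⟩ := ha N hN s (hΓ.functional (hg _ _) hlast)
  refine ⟨SSet.yonedaEquiv σ, fun k θ hθ => ?_⟩
  let t : (∂Δ[N] : SSet.{u}).obj (op k) := ⟨SSet.stdSimplex.objEquiv.symm θ,
    fun h => hθ (SimplexCategory.epi_iff_surjective.2 h)⟩
  have h1 : A.map θ.op (SSet.yonedaEquiv σ) = g _ t := by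
    have h2 : σ.app _ t.1 = g _ t := types_congr_hom (NatTrans.congr_app hσ (op k)) t
    rw [← h2, ← yonedaEquiv_map_comp]
    exact congrArg (σ.app (op k))
      (congrArg SSet.stdSimplex.objEquiv.symm (Category.id_comp θ))
  rw [h1]
  exact hg _ t

/-- A maximal partial equivariant map is defined everywhere, provided that it sends the last
vertices of all new cells to a terminal vertex. -/
lemma exists_mem_of_maximal {Γ : (X ⊗ deltaTop.{u} ⊗ A).Subcomplex}
    (hΓ : Maximal IsPartialEquivariant Γ) {a : A _⦋0⦌} (ha : IsTerminalVertex a)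
    (h : ∀ (N : ℕ) (x : X _⦋N⦌) (y : deltaTop.{u} _⦋N⦌), IsReduced y →
      (∃ b, (x, y, b) ∈ Γ.obj (op ⦋N⦌)) ∨
      (X.map (lastHom ⦋N⦌).op x, zeroSimplex (op ⦋0⦌), a) ∈ Γ.obj (op ⦋0⦌))
    (N : ℕ) (x : X _⦋N⦌) (y : deltaTop.{u} _⦋N⦌) : ∃ b, (x, y, b) ∈ Γ.obj (op ⦋N⦌) := by
  induction N using Nat.strong_induction_on with | _ N ih =>
  obtain ⟨m, y, rfl, hy⟩ := exists_eq_act y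
  suffices h : ∃ b, (x, y, b) ∈ Γ.obj (op ⦋N⦌) from
    h.elim fun b hb => ⟨_, hΓ.prop.act_mem m hb⟩
  -- A reduced simplex of least dimension outside of the domain; the aim is to adjoin it as a cell.
  by_contra! hxy
  have hlast := (h N x y hy).resolve_left (by simpa using hxy)
  rw [← hy.map_lastHom] at hlast
  -- In dimension zero, the simplex is its own last vertex, which is in the domain.
  have hN : 1 ≤ N := by
    by_contra! hN
    obtain rfl : N = 0 := by lia
    have h0 : lastHom ⦋0⦌ = 𝟙 _ := Subsingleton.elim _ _
    rw [h0, op_id, X.map_id_apply, deltaTop.{u}.map_id_apply] at hlast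
    exact hxy _ hlast
  have hfactor : ∀ {k : SimplexCategory} {M : ℕ} (φ : k ⟶ ⦋M⦌) (x' : X _⦋M⦌)
      (y' : deltaTop.{u} _⦋M⦌), M < N →
      ∃ b, (X.map φ.op x', deltaTop.{u}.map φ.op y', b) ∈ Γ.obj (op k) := fun φ x' y' hM => by
    obtain ⟨b, hb⟩ := ih _ hM x' y'
    exact ⟨_, map_mem Γ φ.op hb⟩
  have hnd : (x, y) ∈ (X ⊗ deltaTop.{u}).nonDegenerate N := by
    rintro ⟨M, hM, φ, ⟨x', y'⟩, hxy'⟩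
    obtain ⟨b, hb⟩ := hfactor φ x' y' hM
    have hx : X.map φ.op x' = x := congrArg Prod.fst hxy'
    have hy : deltaTop.{u}.map φ.op y' = y := congrArg Prod.snd hxy'
    rw [hx, hy] at hb
    exact hxy _ hb
  have hdom : ∀ (k : SimplexCategory) (θ : k ⟶ ⦋N⦌), ¬ Epi θ →
      ∃ b, (X.map θ.op x, deltaTop.{u}.map θ.op y, b) ∈ Γ.obj (op k) := fun k θ hθ => by
    obtain ⟨M, rfl⟩ := Nat.exists_eq_add_of_le' hN
    obtain ⟨i, θ', rfl⟩ := SimplexCategory.eq_comp_δ_of_not_surjective θ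
      (fun h => hθ (SimplexCategory.epi_iff_surjective.2 h))
    rw [op_comp, X.map_comp_apply, deltaTop.{u}.map_comp_apply]
    exact hfactor _ _ _ (Nat.lt_succ_self M)
  obtain ⟨τ, hτ⟩ := exists_filler hΓ.prop ha hN x y hdom hlast
  exact hxy τ (hΓ.le_of_ge (isPartialEquivariant_adjoinCell (hΓ := hΓ.prop) (hτ := hτ) hy hnd hxy)
    le_adjoinCell _ mem_adjoinCell)

/-- A partial equivariant map defined everywhere is an equivariant map. -/
lemma exists_isEquivariant {Γ : (X ⊗ deltaTop.{u} ⊗ A).Subcomplex}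
    (hΓ : IsPartialEquivariant Γ)
    (h : ∀ (N : ℕ) (x : X _⦋N⦌) (y : deltaTop.{u} _⦋N⦌), ∃ b, (x, y, b) ∈ Γ.obj (op ⦋N⦌)) :
    ∃ f : X ⊗ deltaTop.{u} ⟶ A, IsEquivariant f ∧
      ∀ (k : SimplexCategoryᵒᵖ) (x : X.obj k) (y : deltaTop.{u}.obj k),
        (x, y, f.app k (x, y)) ∈ Γ.obj k := by
  have h' : ∀ (k : SimplexCategoryᵒᵖ) (x : X.obj k) (y : deltaTop.{u}.obj k),
      ∃ b, (x, y, b) ∈ Γ.obj k := fun ⟨⟨N⟩⟩ x y => h N x y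
  choose g hg using h'
  refine ⟨{ app k := ↾fun p => g k p.1 p.2
            naturality k k' θ := ConcreteCategory.hom_ext _ _ fun p =>
              hΓ.functional (hg k' _ _) (map_mem Γ θ (hg k _ _)) },
    fun k m x w => hΓ.functional (hg _ _ _) (hΓ.act_mem m (hg _ _ _)), fun k x y => hg k x y⟩

/-- The projection of a weighted limit, in terms of equivariant maps. -/
lemma weightedLimitProj_app {W : SSet.{u}} [ModObj deltaPlus.{u} W] (w : W _⦋0⦌)
    (v : X ⟶ weightedLimit W A) {k : SimplexCategoryᵒᵖ} (x : X.obj k) :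
    (v ≫ weightedLimitProj A w).app k x =
      (weightedLimitHomEquiv W A X v).1.app k (x, W.map (k.unop.const ⦋0⦌ 0).op w) :=
  rfl

/-! ### Lifting against `∂Δⁿ ⊆ Δⁿ` -/

variable {n : ℕ}

/-- The partial equivariant map defined on `∂Δⁿ × Δ[t] ∪ Δⁿ × (Δ₊ ⊕ [0])` by the equivariant map
`g` and the map `w`. -/
def initialGraph (g : (∂Δ[n] : SSet.{u}) ⊗ deltaTop.{u} ⟶ A) (w : Δ[n] ⟶ A) :
    ((Δ[n] : SSet.{u}) ⊗ deltaTop.{u} ⊗ A).Subcomplex where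
  obj k := Set.ofPred (fun p => (∃ h : p.1 ∈ (∂Δ[n]).obj k, p.2.2 = g.app k (⟨p.1, h⟩, p.2.1)) ∨
    ∃ m, p.2.1 = act m (zeroSimplex k) ∧ p.2.2 = act m (w.app k p.1))
  map {k k'} θ := by
    rintro ⟨x, y, b⟩ (⟨hx, hb⟩ | ⟨m, hy, hb⟩)
    · exact Or.inl ⟨(∂Δ[n]).map θ hx,
        (congrArg _ hb).trans (types_congr_hom (g.naturality θ) (⟨x, hx⟩, y)).symm⟩
    · exact Or.inr ⟨deltaPlus.{u}.map θ m, (congrArg _ hy).trans (map_act θ m _),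
        (congrArg _ hb).trans ((map_act θ m _).trans
          (congrArg (act _) (types_congr_hom (w.naturality θ) x).symm))⟩

lemma isPartialEquivariant_initialGraph {g : (∂Δ[n] : SSet.{u}) ⊗ deltaTop.{u} ⟶ A}
    (hg : IsEquivariant g) {w : Δ[n] ⟶ A}
    (hgw : ∀ (k : SimplexCategoryᵒᵖ) (x : (∂Δ[n] : SSet.{u}).obj k),
      g.app k (x, zeroSimplex k) = w.app k x.1) :
    IsPartialEquivariant (initialGraph g w) where
  functional {k x y b b'} h h' := by
    have compat : ∀ (hx : x ∈ (∂Δ[n]).obj k) (m : deltaPlus.{u}.obj k),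
        g.app k (⟨x, hx⟩, act m (zeroSimplex k)) = act m (w.app k x) := fun hx m =>
      (hg k m ⟨x, hx⟩ (zeroSimplex k)).trans (congrArg (act m) (hgw k ⟨x, hx⟩))
    rcases h with ⟨hx, hb⟩ | ⟨m, hy, hb⟩ <;> rcases h' with ⟨hx', hb'⟩ | ⟨m', hy', hb'⟩
    · exact hb.trans hb'.symm
    · obtain rfl : y = _ := hy'
      exact hb.trans ((compat hx m').trans hb'.symm)
    · obtain rfl : y = _ := hy
      exact (hb'.trans ((compat hx' m).trans hb.symm)).symm
    · obtain ⟨rfl, -⟩ := eq_of_act_eq (hy.symm.trans hy') (isReduced_zeroSimplex k)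
        (isReduced_zeroSimplex k)
      exact hb.trans hb'.symm
  act_mem {k x y b} m h := by
    rcases h with ⟨hx, hb⟩ | ⟨m', hy, hb⟩
    · exact Or.inl ⟨hx, (congrArg (act m) hb).trans (hg k m ⟨x, hx⟩ y).symm⟩
    · exact Or.inr ⟨(MonObj.mul (X := deltaPlus.{u})).app k (m, m'),
        (congrArg (act m) hy).trans (act_mul _ _ _).symm,
        (congrArg (act m) hb).trans (act_mul _ _ _).symm⟩
  saturated {k x y b m} h := by
    rcases h with ⟨hx, hb⟩ | ⟨m', hy, hb⟩
    · exact ⟨g.app k (⟨x, hx⟩, y), Or.inl ⟨hx, rfl⟩⟩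
    · obtain ⟨m'', y'', rfl, hy''⟩ := exists_eq_act y
      obtain ⟨-, rfl⟩ := eq_of_act_eq ((act_mul _ _ _).trans hy) hy'' (isReduced_zeroSimplex k)
      exact ⟨act m'' (w.app k x), Or.inr ⟨m'', rfl, rfl⟩⟩

/-- The forgetful map has the right lifting property against `∂Δⁿ ⊆ Δⁿ` for those squares that send
the final vertex of `Δⁿ` to a terminal vertex. -/
lemma exists_lift {a : A _⦋0⦌} (ha : IsTerminalVertex a)
    (v : (∂Δ[n] : SSet.{u}) ⟶ weightedLimit deltaTop.{u} A) (w : Δ[n] ⟶ A)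
    (hvw : v ≫ weightedLimitProj A (ComposableArrows.mk₀ (⟨0⟩ : DeltaTop.{u})) = ∂Δ[n].ι ≫ w)
    (hw : w.app (op ⦋0⦌) (lastVertex n) = a) :
    ∃ l : Δ[n] ⟶ weightedLimit deltaTop.{u} A, ∂Δ[n].ι ≫ l = v ∧
      l ≫ weightedLimitProj A (ComposableArrows.mk₀ (⟨0⟩ : DeltaTop.{u})) = w := by
  let g := weightedLimitHomEquiv _ A _ v
  have hgw : ∀ (k : SimplexCategoryᵒᵖ) (x : (∂Δ[n] : SSet.{u}).obj k),
      g.1.app k (x, zeroSimplex k) = w.app k x.1 := fun k x =>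
    types_congr_hom (NatTrans.congr_app hvw k) x
  have hΓ₀ := isPartialEquivariant_initialGraph g.2 hgw
  obtain ⟨Γ, hle, hΓ⟩ := exists_maximal hΓ₀
  have hbdry : ∀ (k : SimplexCategoryᵒᵖ) (x : (∂Δ[n] : SSet.{u}).obj k) (y : deltaTop.{u}.obj k),
      (x.1, y, g.1.app k (x, y)) ∈ Γ.obj k := fun k x y => hle _ (Or.inl ⟨x.2, rfl⟩)
  have hzero : ∀ (k : SimplexCategoryᵒᵖ) (x : (Δ[n] : SSet.{u}).obj k),
      (x, zeroSimplex k, w.app k x) ∈ Γ.obj k := fun k x =>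
    hle _ (Or.inr ⟨_, (act_one _).symm, (act_one _).symm⟩)
  obtain ⟨f, hf, hfΓ⟩ := exists_isEquivariant hΓ.prop
    (exists_mem_of_maximal hΓ ha fun N x y hy => by
      by_cases hx : x ∈ (∂Δ[n] : (Δ[n] : SSet.{u}).Subcomplex).obj (op ⦋N⦌)
      · exact Or.inl ⟨_, hbdry _ ⟨x, hx⟩ y⟩
      · right
        -- A simplex of `Δⁿ` outside of the boundary is surjective, so its last vertex is `n`.
        have hx' : Function.Surjective (SSet.stdSimplex.asOrderHom x) := not_not.1 hx
        have hlast : (Δ[n] : SSet.{u}).map (lastHom ⦋N⦌).op x = lastVertex n := by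
          obtain ⟨i, hi⟩ := hx' (Fin.last n)
          have h : SSet.stdSimplex.asOrderHom x (Fin.last N) = Fin.last n :=
            top_unique (hi.ge.trans ((SSet.stdSimplex.asOrderHom x).monotone (Fin.le_last i)))
          refine SSet.stdSimplex.objEquiv.injective (SimplexCategory.Hom.ext _ _ ?_)
          exact OrderHom.ext _ _ (funext fun _ => h)
        rw [hlast, ← hw]
        exact hzero _ _)
  refine ⟨(weightedLimitHomEquiv _ A _).symm ⟨f, hf⟩, ?_, ?_⟩
  · refine (weightedLimitHomEquiv _ A _).injective (Subtype.ext ?_)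
    refine NatTrans.ext (funext fun k => ConcreteCategory.hom_ext _ _ fun p => ?_)
    have h : (weightedLimitHomEquiv _ A _ (∂Δ[n].ι ≫
        (weightedLimitHomEquiv _ A _).symm ⟨f, hf⟩)).1.app k p =
        (weightedLimitHomEquiv _ A _ ((weightedLimitHomEquiv _ A _).symm ⟨f, hf⟩)).1.app k
          (p.1.1, p.2) := rfl
    refine h.trans ?_
    rw [Equiv.apply_symm_apply]
    exact hΓ.prop.functional (hfΓ _ _ _) (hbdry k p.1 p.2)
  · refine NatTrans.ext (funext fun k => ConcreteCategory.hom_ext _ _ fun x => ?_)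
    refine (weightedLimitProj_app _ _ x).trans ?_
    rw [Equiv.apply_symm_apply]
    exact hΓ.prop.functional (hfΓ _ _ _) (hzero k x)

end HCMonad


theorem mainTheorem6 (T : HCMonad.HomotopyCoherentMonad.{u}) :
    HCMonad.CreatesTerminal (HCMonad.forgetful T) ∧
      ∀ a : T.base _⦋0⦌, HCMonad.IsTerminalVertex a →
        ∀ (n : ℕ) (v : (∂Δ[n] : SSet.{u}) ⟶ HCMonad.algebras T) (w : Δ[n] ⟶ T.base),
          v ≫ HCMonad.forgetful T = ∂Δ[n].ι ≫ w →
          w.app (op ⦋0⦌) (HCMonad.lastVertex n) = a →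
          ∃ l : Δ[n] ⟶ HCMonad.algebras T, ∂Δ[n].ι ≫ l = v ∧ l ≫ HCMonad.forgetful T = w := by
  refine ⟨fun a ha => ⟨?_, fun e he n hn s hs => ?_⟩,
    fun a ha n v w hvw hw => HCMonad.exists_lift ha v w hvw hw⟩
  · -- The case `n = 0`: the boundary of `Δ⁰` is empty.
    have hinit : Limits.IsInitial ((∂Δ[0] : (Δ[0] : SSet.{u}).Subcomplex) : SSet.{u}) := by
      rw [SSet.boundary_zero]
      exact SSet.Subcomplex.isInitialBot
    have h0 : (SSet.yonedaEquiv.symm a).app (op ⦋0⦌) (HCMonad.lastVertex 0) = a := by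
      have h : HCMonad.lastVertex.{u} 0 = SSet.stdSimplex.objEquiv.symm (𝟙 ⦋0⦌) :=
        SSet.stdSimplex.objEquiv.injective (Subsingleton.elim (α := ⦋0⦌ ⟶ ⦋0⦌) _ _)
      rw [h]
      exact SSet.yonedaEquiv.apply_symm_apply a
    obtain ⟨l, -, hl⟩ := HCMonad.exists_lift ha (hinit.to (HCMonad.algebras T))
      (SSet.yonedaEquiv.symm a) (hinit.hom_ext _ _) h0
    refine ⟨l.app _ (HCMonad.lastVertex 0), ?_⟩
    exact (types_congr_hom (NatTrans.congr_app hl _) (HCMonad.lastVertex 0)).trans h0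
  · obtain ⟨w, hw⟩ := ha n hn (s ≫ HCMonad.forgetful T) ((congrArg _ hs).trans he)
    obtain ⟨l, hl, -⟩ := HCMonad.exists_lift ha s w hw.symm
      ((types_congr_hom (NatTrans.congr_app hw _) (HCMonad.boundaryLastVertex n hn)).trans
        ((congrArg _ hs).trans he))
    exact ⟨l, hl⟩
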